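/- Let $d\ge 2$, $D=\{1,\dots,d\}$, $\mathcal X=(0,1)^d$, and $X=L^2(\mathcal X)$ (real-valued). For $\emptyset\ne\alpha\subseteq D$ put $\mathcal X_\alpha=(0,1)^{|\alpha|}$, $X_\alpha=L^2(\mathcal X_\alpha)$, $\alpha^c=D\setminus\alpha$, and for $f\in X$ let $f^\alpha(x_{\alpha^c})=f(\cdot,x_{\alpha^c})\in X_\alpha$, which is defined for almost every $x_{\alpha^c}\in\mathcal X_{\alpha^c}$. For a subspace $V\subseteq X_\alpha$ and $u\in X_\alpha$ let $E(u,V)_{X_\alpha}=\inf_{v\in V}\|u-v\|_{X_\alpha}$. For $\alpha\neq D$ and an integer $n\ge 0$ define $$\delta^\alpha_n(f)=\inf_{\dim V=n}\Bigl(\int_{\mathcal X_{\alpha^c}}E\bigl(f^\alpha(x_{\alpha^c}),V\bigr)_{X_\alpha}^2\,dx_{\alpha^c}\Bigr)^{1/2},$$ where $V$ ranges over the $n$-dimensional subspaces of $X_\alpha$. Let $\mathrm{rank}_\alpha(f)$ be the dimension of the range of the operator $X_{\alpha^c}\to X_\alpha$, $v\mapsto\int_{\mathcal X_{\alpha^c}}f^\alpha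 v\,dx_{\alpha^c}$ (for $\alpha=D$, the space $X_\emptyset$ is the space $\mathbb R$ of constants, so that $\mathrm{rank}_D(f)\le 1$). Let $T$ be a dimension partition tree over $D$: its nodes are nonempty subsets of $D$, its root is $D$, every node is either a leaf, in which case it is a singleton, or an interior node, in which case its sons are at least two nodes that form a partition of it, and every node other than $D$ is a son of some node. Let $\mathcal I(T)$ be the set of interior nodes. Let $r=(r_\alpha)_{\alpha\in T}$ be a tuple of nonnegative integers with $r_D=1$. For a subspace $W\subseteq X$ set $$\mathcal T_r^T(W)=\{v\in W:\ \mathrm{rank}_\alpha(v)\le r_\alpha\text{ for all }\alpha\in T\},\qquad e^T_{r,W}(f)_X=\inf_{v\in\mathcal T_r^T(W)}\|f-v\|_X,$$ and $e^T_r(f)_X=e^T_{r,X}(f)_X$. Assume that $r$ is admissible, that is, $\mathcal T_r^T(X)\neq\emptyset$. Then for every $f\in X$, $$e_r^T(f)_X^2\le\sum_{\alpha\in T\setminus\{D\}}\bigl(\delta^\alpha_{r_\alpha}(f)\bigr)^2 .$$ Furthermore, for all finite-dimensional subspaces $U_\nu\subseteq X_{\{\nu\}}$, $1\le\nu\le d$,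 and $U=U_1\otimes\cdots\otimes U_d\subseteq X$ (the span of the products $u_1(x_1)\cdots u_d(x_d)$ with $u_\nu\in U_\nu$), $$e_{r,U}^T(f)_X^2\le\sum_{\nu=1}^d\int_{\mathcal X_{\{\nu\}^c}}E\bigl(f^{\{\nu\}}(x_{\{\nu\}^c}),U_\nu\bigr)_{X_{\{\nu\}}}^2\,dx_{\{\nu\}^c}+\sum_{\alpha\in A\setminus\{D\}}\bigl(\delta^\alpha_{r_\alpha}(f)\bigr)^2,$$ where $A=\mathcal I(T)$ if $\dim U_\nu=r_{\{\nu\}}$ for all $1\le\nu\le d$, and $A=T$ otherwise. -/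

import Mathlib

open MeasureTheory Set
open scoped ENNReal

noncomputable section

namespace TreeTensor

/-! ### Square-integrable functions on the unit cube -/

/-- Lebesgue measure on the cube `(0,1)^ι`, as a measure on `ι → ℝ`. -/
def cube (ι : Type) [Fintype ι] : Measure (ι → ℝ) :=
  Measure.pi fun _ => (volume : Measure ℝ).restrict (Ioo 0 1)

instance instProbCube (ι : Type) [Fintype ι] : IsProbabilityMeasure (cube ι) := by
  have : IsProbabilityMeasure ((volume : Measure ℝ).restrict (Ioo (0 : ℝ) 1)) :=
    ⟨by simp⟩
  unfold cube
  infer_instance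

instance instSFiniteCube (ι : Type) [Fintype ι] : SFinite (cube ι) :=
  @instSFiniteOfSigmaFinite _ _ _ (@IsFiniteMeasure.toSigmaFinite _ _ _ inferInstance)

/-- The real Hilbert space `L²((0,1)^ι)`. -/
abbrev Ltwo (ι : Type) [Fintype ι] : Type := Lp ℝ 2 (cube ι)

variable {d : ℕ}

/-- The point of `ℝ^d` with coordinates `x` in the directions of `α` and `y` in the other ones. -/
def glue (α : Finset (Fin d)) (x : {i // i ∈ α} → ℝ) (y : {i // i ∉ α} → ℝ) : Fin d → ℝ :=
  fun i => if h : i ∈ α then x ⟨i, h⟩ else y ⟨i, h⟩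

open Classical in
/-- The partial evaluation `f^α(y) = f(·, y)`, as an element of `L²((0,1)^α)`. It is given by the
first case for almost every `y` (see `ae_memLp_glue`). -/
def slice (α : Finset (Fin d)) (f : Ltwo (Fin d)) (y : {i // i ∉ α} → ℝ) : Ltwo {i // i ∈ α} :=
  if h : MemLp (fun x => f (glue α x y)) 2 (cube {i // i ∈ α}) then h.toLp _ else 0

lemma measurable_glue (α : Finset (Fin d)) :
    Measurable fun p : ({i // i ∈ α} → ℝ) × ({i // i ∉ α} → ℝ) => glue α p.1 p.2 :=
  (MeasurableEquiv.piEquivPiSubtypeProd (fun _ : Fin d => ℝ) (· ∈ α)).symm.measurable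

lemma measurePreserving_glue (α : Finset (Fin d)) :
    MeasurePreserving (fun p : ({i // i ∈ α} → ℝ) × ({i // i ∉ α} → ℝ) => glue α p.1 p.2)
      ((cube {i // i ∈ α}).prod (cube {i // i ∉ α})) (cube (Fin d)) := by
  have h := (measurePreserving_piEquivPiSubtypeProd
    (fun _ : Fin d => (volume : Measure ℝ).restrict (Ioo 0 1)) (· ∈ α)).symm
  unfold cube
  convert! h using 3

lemma measurable_coe_glue (α : Finset (Fin d)) (f : Ltwo (Fin d)) :
    Measurable fun p : ({i // i ∈ α} → ℝ) × ({i // i ∉ α} → ℝ) => f (glue α p.1 p.2) :=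
  (Lp.stronglyMeasurable f).measurable.comp (measurable_glue α)

lemma lintegral_glue_lt_top (α : Finset (Fin d)) (f : Ltwo (Fin d)) :
    ∫⁻ y, ∫⁻ x, ‖f (glue α x y)‖ₑ ^ (2 : ℝ) ∂cube {i // i ∈ α} ∂cube {i // i ∉ α} < ∞ := by
  have h := (Lp.memLp f).comp_measurePreserving (measurePreserving_glue α)
  have h2 := lintegral_rpow_enorm_lt_top_of_eLpNorm_lt_top (by norm_num) (by norm_num) h.2
  rw [lintegral_prod_symm' (μ := cube {i // i ∈ α}) (ν := cube {i // i ∉ α})] at h2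
  · simpa using h2
  · exact (measurable_coe_glue α f).enorm.pow_const _

lemma measurable_lintegral_glue (α : Finset (Fin d)) (f : Ltwo (Fin d)) :
    Measurable fun y => ∫⁻ x, ‖f (glue α x y)‖ₑ ^ (2 : ℝ) ∂cube {i // i ∈ α} :=
  Measurable.lintegral_prod_left' (μ := cube {i // i ∈ α})
    ((measurable_coe_glue α f).enorm.pow_const (2 : ℝ))

lemma memLp_glue_iff (α : Finset (Fin d)) (f : Ltwo (Fin d)) (y : {i // i ∉ α} → ℝ) :
    MemLp (fun x => f (glue α x y)) 2 (cube {i // i ∈ α}) ↔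
      ∫⁻ x, ‖f (glue α x y)‖ₑ ^ (2 : ℝ) ∂cube {i // i ∈ α} < ∞ := by
  have hm : AEStronglyMeasurable (fun x => f (glue α x y)) (cube {i // i ∈ α}) :=
    ((measurable_coe_glue α f).comp measurable_prodMk_right).aestronglyMeasurable
  have := eLpNorm_lt_top_iff_lintegral_rpow_enorm_lt_top (p := 2)
    (f := fun x => f (glue α x y)) (μ := cube {i // i ∈ α}) (by norm_num) (by norm_num)
  simp only [ENNReal.toReal_ofNat] at this
  rw [← this]
  exact ⟨fun h => h.2, fun h => ⟨hm, h⟩⟩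

lemma ae_memLp_glue (α : Finset (Fin d)) (f : Ltwo (Fin d)) :
    ∀ᵐ y ∂cube {i // i ∉ α}, MemLp (fun x => f (glue α x y)) 2 (cube {i // i ∈ α}) := by
  filter_upwards [ae_lt_top (measurable_lintegral_glue α f) (lintegral_glue_lt_top α f).ne]
    with y hy
  exact (memLp_glue_iff α f y).2 hy

lemma measurable_of_measurable_edist {Ω E : Type*} [MeasurableSpace Ω] [PseudoEMetricSpace E]
    [SecondCountableTopology E] [MeasurableSpace E] [BorelSpace E] {g : Ω → E}
    (h : ∀ c, Measurable fun y => edist (g y) c) : Measurable g := by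
  refine measurable_of_isOpen fun s hs => ?_
  have hb : ∀ x : s, ∃ ε : ℝ≥0∞, 0 < ε ∧ Metric.eball (x : E) ε ⊆ s := fun x =>
    EMetric.isOpen_iff.1 hs x x.2
  choose ε hε hsub using hb
  obtain ⟨t, ht, htU⟩ := TopologicalSpace.isOpen_iUnion_countable
    (fun x : s => Metric.eball (x : E) (ε x)) (fun x => Metric.isOpen_eball)
  have hs' : s = ⋃ x ∈ t, Metric.eball (x : E) (ε x) := by
    rw [htU]
    refine Set.Subset.antisymm (fun x hx => ?_) (Set.iUnion_subset hsub)
    exact Set.mem_iUnion.2 ⟨⟨x, hx⟩, Metric.mem_eball_self (hε _)⟩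
  rw [hs']
  simp only [Set.preimage_iUnion]
  exact MeasurableSet.biUnion ht fun x _ => h x measurableSet_Iio

instance instCountableCube (ι : Type) [Fintype ι] : SecondCountableTopology (Ltwo ι) := by
  have : Fact ((2 : ℝ≥0∞) ≠ ∞) := ⟨by norm_num⟩
  exact Lp.SecondCountableTopology

lemma stronglyMeasurable_slice (α : Finset (Fin d)) (f : Ltwo (Fin d)) :
    StronglyMeasurable (slice α f) := by
  let _ : MeasurableSpace (Ltwo {i // i ∈ α}) := borel _
  have : BorelSpace (Ltwo {i // i ∈ α}) := ⟨rfl⟩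
  classical
  refine Measurable.stronglyMeasurable (measurable_of_measurable_edist fun c => ?_)
  have key : (fun y => edist (slice α f y) c) = fun y =>
      if ∫⁻ x, ‖f (glue α x y)‖ₑ ^ (2 : ℝ) ∂cube {i // i ∈ α} < ∞ then
        (∫⁻ x, ‖f (glue α x y) - c x‖ₑ ^ (2 : ℝ) ∂cube {i // i ∈ α}) ^ (1 / 2 : ℝ)
      else edist 0 c := by
    funext y
    by_cases h : MemLp (fun x => f (glue α x y)) 2 (cube {i // i ∈ α})
    · rw [if_pos ((memLp_glue_iff α f y).1 h), slice, dif_pos h]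
      conv_lhs => rw [← Lp.toLp_coeFn c (Lp.memLp c)]
      rw [Lp.edist_toLp_toLp,
        eLpNorm_eq_lintegral_rpow_enorm_toReal (by norm_num) (by norm_num)]
      simp
    · rw [if_neg (fun h' => h ((memLp_glue_iff α f y).2 h')), slice, dif_neg h]
  rw [key]
  refine Measurable.ite (measurableSet_lt (measurable_lintegral_glue α f) measurable_const) ?_
    measurable_const
  refine Measurable.pow_const (Measurable.lintegral_prod_left' (μ := cube {i // i ∈ α})
    (f := fun p : ({i // i ∈ α} → ℝ) × ({i // i ∉ α} → ℝ) =>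
      ‖f (glue α p.1 p.2) - c p.1‖ₑ ^ (2 : ℝ)) ?_) _
  exact ((measurable_coe_glue α f).sub
    ((Lp.stronglyMeasurable c).measurable.comp measurable_fst)).enorm.pow_const _

lemma memLp_slice (α : Finset (Fin d)) (f : Ltwo (Fin d)) :
    MemLp (slice α f) 2 (cube {i // i ∉ α}) := by
  refine ⟨(stronglyMeasurable_slice α f).aestronglyMeasurable, ?_⟩
  rw [eLpNorm_lt_top_iff_lintegral_rpow_enorm_lt_top (by norm_num) (by norm_num)]
  refine lt_of_eq_of_lt (lintegral_congr_ae ?_) (lintegral_glue_lt_top α f)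
  filter_upwards [ae_memLp_glue α f] with y hy
  rw [slice, dif_pos hy, Lp.enorm_toLp,
    eLpNorm_eq_lintegral_rpow_enorm_toReal (by norm_num) (by norm_num), ← ENNReal.rpow_mul]
  simp

lemma integrable_smul_slice (α : Finset (Fin d)) (f : Ltwo (Fin d)) (v : Ltwo {i // i ∉ α}) :
    Integrable (fun y => v y • slice α f y) (cube {i // i ∉ α}) :=
  memLp_one_iff_integrable.1 ((memLp_slice α f).smul (Lp.memLp v))

/-! ### Ranks and widths -/

/-- The operator `S^α_f : L²((0,1)^{αᶜ}) → L²((0,1)^α)`, `v ↦ ∫ f^α(y) v(y) dy`. -/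
def sliceOp (α : Finset (Fin d)) (f : Ltwo (Fin d)) :
    Ltwo {i // i ∉ α} →ₗ[ℝ] Ltwo {i // i ∈ α} where
  toFun v := ∫ y, v y • slice α f y ∂cube {i // i ∉ α}
  map_add' v w := by
    rw [← integral_add (integrable_smul_slice α f v) (integrable_smul_slice α f w)]
    refine integral_congr_ae ?_
    filter_upwards [Lp.coeFn_add v w] with y hy
    rw [hy, Pi.add_apply, add_smul]
  map_smul' c v := by
    rw [RingHom.id_apply, ← integral_smul]
    refine integral_congr_ae ?_
    filter_upwards [Lp.coeFn_smul c v] with y hy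
    rw [hy, Pi.smul_apply, smul_eq_mul, mul_smul]

/-- The `α`-rank of `f`: the (possibly infinite) dimension of the range of `S^α_f`. -/
def alphaRank (α : Finset (Fin d)) (f : Ltwo (Fin d)) : Cardinal :=
  Module.rank ℝ (LinearMap.range (sliceOp α f))

/-- `∫ E(f^α(y), V)² dy`, where `E(u, V)` is the distance of `u` from `V` in `L²((0,1)^α)`. -/
def sqProjError (α : Finset (Fin d)) (f : Ltwo (Fin d)) (V : Submodule ℝ (Ltwo {i // i ∈ α})) : ℝ :=
  ∫ y, Metric.infDist (slice α f y) (V : Set (Ltwo {i // i ∈ α})) ^ 2 ∂cube {i // i ∉ α}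

/-- The average linear width `δ^α_n(f)`: the infimum over all `n`-dimensional subspaces `V` of
`L²((0,1)^α)` of the square root of `∫ E(f^α(y), V)² dy`. -/
def width (α : Finset (Fin d)) (n : ℕ) (f : Ltwo (Fin d)) : ℝ :=
  ⨅ V : {V : Submodule ℝ (Ltwo {i // i ∈ α}) // Module.rank ℝ V = (n : Cardinal)},
    Real.sqrt (sqProjError α f V.1)

/-! ### Dimension partition trees -/

/-- A dimension partition tree over `{1, …, d}`: a set of nonempty subsets that contains the full
set (the root), with sons for each node. The sons of a node are either none, in which case the node
is a singleton, or at least two nodes that partition it. Every node other than the root is a son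
of some node. -/
structure DimTree (d : ℕ) where
  nodes : Finset (Finset (Fin d))
  sons : Finset (Fin d) → Finset (Finset (Fin d))
  root_mem : Finset.univ ∈ nodes
  nonempty_of_mem : ∀ α ∈ nodes, α.Nonempty
  sons_subset : ∀ α ∈ nodes, sons α ⊆ nodes
  exists_parent : ∀ β ∈ nodes, β ≠ Finset.univ → ∃ α ∈ nodes, β ∈ sons α
  leaf_or_two_le : ∀ α ∈ nodes, sons α = ∅ ∨ 2 ≤ (sons α).card
  sons_disjoint : ∀ α ∈ nodes, ∀ β ∈ sons α, ∀ γ ∈ sons α, β ≠ γ → Disjoint β γ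
  sons_cover : ∀ α ∈ nodes, (sons α).Nonempty → (sons α).biUnion id = α
  card_leaf : ∀ α ∈ nodes, sons α = ∅ → α.card = 1

/-- The interior nodes, i.e. those that have sons. -/
def DimTree.interior (T : DimTree d) : Finset (Finset (Fin d)) :=
  T.nodes.filter fun α => (T.sons α).Nonempty

/-! ### Tree tensor formats -/

/-- The tensor product `U_1 ⊗ ⋯ ⊗ U_d` inside `L²((0,1)^d)`: the span of all products
`u_1(x_1) ⋯ u_d(x_d)` with `u_ν ∈ U_ν`. -/
def tensorSpace (U : ∀ ν : Fin d, Submodule ℝ (Ltwo {i // i ∈ ({ν} : Finset (Fin d))})) :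
    Submodule ℝ (Ltwo (Fin d)) :=
  Submodule.span ℝ {v | ∃ u : ∀ ν : Fin d, Ltwo {i // i ∈ ({ν} : Finset (Fin d))},
    (∀ ν, u ν ∈ U ν) ∧ v =ᵐ[cube (Fin d)] fun x => ∏ ν, u ν fun i => x i}

/-- The tree tensor format `T_r^T(W)` of the elements of `W` whose `α`-rank is at most `r α` for
every node `α`. -/
def treeFormat (T : DimTree d) (r : Finset (Fin d) → ℕ) (W : Submodule ℝ (Ltwo (Fin d))) :
    Set (Ltwo (Fin d)) :=
  {v | v ∈ W ∧ ∀ α ∈ T.nodes, alphaRank α v ≤ (r α : Cardinal)}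

/-- The rank tuple `r` is admissible if the format `T_r^T(L²((0,1)^d))` is nonempty. -/
def Admissible (T : DimTree d) (r : Finset (Fin d) → ℕ) : Prop :=
  (treeFormat T r ⊤).Nonempty

/-- The error `e_{r,W}^T(f)` of best approximation in `L²((0,1)^d)` of `f` from `T_r^T(W)`. -/
def bestError (T : DimTree d) (r : Finset (Fin d) → ℕ) (W : Submodule ℝ (Ltwo (Fin d)))
    (f : Ltwo (Fin d)) : ℝ :=
  Metric.infDist f (treeFormat T r W)

end TreeTensor

end

/-! Slicing along `α` identifies L² of the cube isometrically with the square-integrable functions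
of the variables outside `α` with values in L² of those inside (`norm_sq_eq_integral_slice`).
Projecting every slice orthogonally onto a finite-dimensional `V` gives an operator P (`nodeProj`).
Since f - Pv = (f - Pf) + P(f - v) with orthogonal summands, ‖f - Pv‖² ≤ ‖f - Pf‖² + ‖f - v‖²
(`norm_sub_nodeProj_sq_le`). Hence successive projections, in any order and without commuting, cost
at most the sum of the squared errors that each one makes on `f` itself.

The order matters only for the ranks, which are controlled through sums of products
(`IsSep.alphaRank_le`). Projecting at `β` creates a sum of dim V products with respect to `β`, and
keeps such a representation with respect to `α` if β ⊆ α or the two are disjoint (`IsSep.nodeProj`).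
Nodes of the tree are nested or disjoint, so projecting from large nodes to small ones destroys no
rank bound already reached.

The projections onto the `U ν` come last: a singleton is contained in or disjoint from any `α`, so
all ranks survive, the result lies in the tensor product, and leaf ranks are bounded by dim U_ν.
Widths appear by taking infima over the subspaces, one node at a time (`le_add_sum_width_sq`). -/

noncomputable section

namespace TreeTensor

variable {d : ℕ}

/-! ### Slices and restrictions -/

/-- The coordinates of `z` in the directions of `α`. -/
def restr (α : Finset (Fin d)) (z : Fin d → ℝ) : {i // i ∈ α} → ℝ := fun i => z i

/-- The coordinates of `z` in the directions outside of `α`. -/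
def corestr (α : Finset (Fin d)) (z : Fin d → ℝ) : {i // i ∉ α} → ℝ := fun i => z i

@[simp] lemma restr_glue (α : Finset (Fin d)) (x : {i // i ∈ α} → ℝ) (y : {i // i ∉ α} → ℝ) :
    restr α (glue α x y) = x := by
  funext i; simp [restr, glue]

@[simp] lemma corestr_glue (α : Finset (Fin d)) (x : {i // i ∈ α} → ℝ) (y : {i // i ∉ α} → ℝ) :
    corestr α (glue α x y) = y := by
  funext i; simp [corestr, glue, i.2]

@[simp] lemma glue_restr_corestr (α : Finset (Fin d)) (z : Fin d → ℝ) :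
    glue α (restr α z) (corestr α z) = z := by
  funext i; simp [restr, corestr, glue]

lemma measurePreserving_restr_corestr (α : Finset (Fin d)) :
    MeasurePreserving (fun z : Fin d → ℝ => (restr α z, corestr α z)) (cube (Fin d))
      ((cube {i // i ∈ α}).prod (cube {i // i ∉ α})) := by
  have h := measurePreserving_piEquivPiSubtypeProd
    (fun _ : Fin d => (volume : Measure ℝ).restrict (Ioo 0 1)) (· ∈ α)
  unfold cube
  convert! h using 3

lemma measurePreserving_restr (α : Finset (Fin d)) :
    MeasurePreserving (restr α) (cube (Fin d)) (cube {i // i ∈ α}) :=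
  measurePreserving_fst.comp (measurePreserving_restr_corestr α)

lemma measurePreserving_corestr (α : Finset (Fin d)) :
    MeasurePreserving (corestr α) (cube (Fin d)) (cube {i // i ∉ α}) :=
  measurePreserving_snd.comp (measurePreserving_restr_corestr α)

lemma ae_ae_glue {α : Finset (Fin d)} {p : (Fin d → ℝ) → Prop} (h : ∀ᵐ z ∂cube (Fin d), p z) :
    ∀ᵐ y ∂cube {i // i ∉ α}, ∀ᵐ x ∂cube {i // i ∈ α}, p (glue α x y) :=
  Measure.ae_ae_of_ae_prod (((measurePreserving_glue α).comp
    Measure.measurePreserving_swap).quasiMeasurePreserving.ae h)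

lemma ae_coeFn_slice (α : Finset (Fin d)) {v : Ltwo (Fin d)} {F : (Fin d → ℝ) → ℝ}
    (h : v =ᵐ[cube (Fin d)] F) :
    ∀ᵐ y ∂cube {i // i ∉ α}, slice α v y =ᵐ[cube {i // i ∈ α}] fun x => F (glue α x y) := by
  filter_upwards [ae_ae_glue (α := α) h, ae_memLp_glue α v] with y hy hm
  rw [slice, dif_pos hm]
  exact hm.coeFn_toLp.trans hy

lemma slice_add (α : Finset (Fin d)) (v w : Ltwo (Fin d)) :
    ∀ᵐ y ∂cube {i // i ∉ α}, slice α (v + w) y = slice α v y + slice α w y := by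
  filter_upwards [ae_coeFn_slice α (Lp.coeFn_add v w), ae_coeFn_slice α (ae_eq_refl (f := v)),
    ae_coeFn_slice α (ae_eq_refl (f := w))] with y h1 h2 h3
  refine Lp.ext ?_
  filter_upwards [h1, h2, h3, Lp.coeFn_add (slice α v y) (slice α w y)] with x h1 h2 h3 h4
  rw [h1, h4, Pi.add_apply, Pi.add_apply, h2, h3]

lemma slice_smul (α : Finset (Fin d)) (c : ℝ) (v : Ltwo (Fin d)) :
    ∀ᵐ y ∂cube {i // i ∉ α}, slice α (c • v) y = c • slice α v y := by
  filter_upwards [ae_coeFn_slice α (Lp.coeFn_smul c v), ae_coeFn_slice α (ae_eq_refl (f := v))]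
    with y h1 h2
  refine Lp.ext ?_
  filter_upwards [h1, h2, Lp.coeFn_smul c (slice α v y)] with x h1 h2 h4
  simp [h1, h2, h4]

lemma slice_sub (α : Finset (Fin d)) (v w : Ltwo (Fin d)) :
    ∀ᵐ y ∂cube {i // i ∉ α}, slice α (v - w) y = slice α v y - slice α w y := by
  have h : v - w = v + (-1 : ℝ) • w := by rw [neg_one_smul, sub_eq_add_neg]
  rw [h]
  filter_upwards [slice_add α v ((-1 : ℝ) • w), slice_smul α (-1) w] with y h1 h2
  rw [h1, h2, neg_one_smul, sub_eq_add_neg]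

lemma slice_sum {ι : Type*} (s : Finset ι) (α : Finset (Fin d)) (t : ι → Ltwo (Fin d)) :
    ∀ᵐ y ∂cube {i // i ∉ α}, slice α (∑ i ∈ s, t i) y = ∑ i ∈ s, slice α (t i) y := by
  classical
  induction s using Finset.induction_on with
  | empty =>
    filter_upwards [slice_smul α 0 (0 : Ltwo (Fin d))] with y hy
    simpa using hy
  | insert a s ha ih =>
    rw [Finset.sum_insert ha]
    filter_upwards [slice_add α (t a) (∑ i ∈ s, t i), ih] with y h1 h2
    rw [h1, h2, Finset.sum_insert ha]

lemma integrable_norm_sq_slice (α : Finset (Fin d)) (v : Ltwo (Fin d)) :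
    Integrable (fun y => ‖slice α v y‖ ^ 2) (cube {i // i ∉ α}) :=
  (memLp_slice α v).integrable_norm_pow (by norm_num)

/-- Fubini. It turns inequalities between slices into inequalities in L² of the cube. -/
lemma norm_sq_eq_integral_slice (α : Finset (Fin d)) (v : Ltwo (Fin d)) :
    ‖v‖ ^ 2 = ∫ y, ‖slice α v y‖ ^ 2 ∂cube {i // i ∉ α} := by
  have hnorm : ∀ {ι : Type} [Fintype ι] (g : Ltwo ι), ‖g‖ ^ 2 = ∫ x, g x ^ 2 ∂cube ι := by
    intro ι _ g
    rw [← real_inner_self_eq_norm_sq, L2.inner_def]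
    simp [pow_two]
  have hint : Integrable (fun p : ({i // i ∉ α} → ℝ) × ({i // i ∈ α} → ℝ) =>
      v (glue α p.2 p.1) ^ 2) ((cube {i // i ∉ α}).prod (cube {i // i ∈ α})) :=
    ((measurePreserving_glue α).comp Measure.measurePreserving_swap).integrable_comp_of_integrable
      (Lp.memLp v).integrable_sq
  have hmap : ∫ z, v z ^ 2 ∂cube (Fin d) = ∫ p : ({i // i ∉ α} → ℝ) × ({i // i ∈ α} → ℝ),
      v (glue α p.2 p.1) ^ 2 ∂(cube {i // i ∉ α}).prod (cube {i // i ∈ α}) := by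
    have hmp := (measurePreserving_glue α).comp
      (Measure.measurePreserving_swap (μ := cube {i // i ∉ α}) (ν := cube {i // i ∈ α}))
    have h := integral_map (μ := (cube {i // i ∉ α}).prod (cube {i // i ∈ α}))
      hmp.measurable.aemeasurable (f := fun z => v z ^ 2)
      ((Lp.stronglyMeasurable v).measurable.pow_const 2).aestronglyMeasurable
    rw [hmp.map_eq] at h
    exact h
  rw [hnorm, hmap, integral_prod _ hint]
  refine integral_congr_ae ?_
  filter_upwards [ae_coeFn_slice α (ae_eq_refl (f := v))] with y hy
  rw [hnorm]
  refine integral_congr_ae ?_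
  filter_upwards [hy] with x hx
  rw [hx]

lemma ext_of_slice (α : Finset (Fin d)) {v w : Ltwo (Fin d)}
    (h : ∀ᵐ y ∂cube {i // i ∉ α}, slice α v y = slice α w y) : v = w := by
  rw [← sub_eq_zero, ← norm_eq_zero, ← sq_eq_zero_iff, norm_sq_eq_integral_slice α]
  refine integral_eq_zero_of_ae ?_
  filter_upwards [h, slice_sub α v w] with y h1 h2
  simp [h1, h2]

/-! ### Projections in the directions of a node -/

/-- The rank-one contraction `v ↦ e ⊗ ⟨e, v⟩` in the directions of `β`, as a function. -/
def contractFun (β : Finset (Fin d)) (e : Ltwo {i // i ∈ β}) (v : Ltwo (Fin d)) :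
    (Fin d → ℝ) → ℝ :=
  fun z => e (restr β z) * inner ℝ e (slice β v (corestr β z))

lemma memLp_mul_restr_corestr (β : Finset (Fin d)) {a : ({i // i ∈ β} → ℝ) → ℝ}
    {b : ({i // i ∉ β} → ℝ) → ℝ} (ha : MemLp a 2 (cube _)) (hb : MemLp b 2 (cube _)) :
    MemLp (fun z => a (restr β z) * b (corestr β z)) 2 (cube (Fin d)) := by
  have h : MemLp (fun p : ({i // i ∈ β} → ℝ) × ({i // i ∉ β} → ℝ) => a p.1 * b p.2) 2
      ((cube {i // i ∈ β}).prod (cube {i // i ∉ β})) := by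
    refine (memLp_two_iff_integrable_sq (ha.1.comp_fst.mul hb.1.comp_snd)).2 ?_
    simpa only [Pi.mul_apply, mul_pow] using ha.integrable_sq.mul_prod hb.integrable_sq
  exact h.comp_measurePreserving (measurePreserving_restr_corestr β)

lemma memLp_contractFun (β : Finset (Fin d)) (e : Ltwo {i // i ∈ β}) (v : Ltwo (Fin d)) :
    MemLp (contractFun β e v) 2 (cube (Fin d)) :=
  memLp_mul_restr_corestr β (Lp.memLp e) ((memLp_slice β v).const_inner e)

lemma slice_toLp_contractFun (β : Finset (Fin d)) (e : Ltwo {i // i ∈ β}) (v : Ltwo (Fin d)) :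
    ∀ᵐ y ∂cube {i // i ∉ β}, slice β ((memLp_contractFun β e v).toLp _) y =
      inner ℝ e (slice β v y) • e := by
  filter_upwards [ae_coeFn_slice β (memLp_contractFun β e v).coeFn_toLp] with y hy
  refine Lp.ext ?_
  filter_upwards [hy, Lp.coeFn_smul (inner ℝ e (slice β v y)) e] with x h1 h2
  rw [h1, h2]
  simp [contractFun, mul_comm]

/-- The operator `v ↦ e ⊗ ⟨e, v⟩` in the directions of `β`. -/
def contract (β : Finset (Fin d)) (e : Ltwo {i // i ∈ β}) : Ltwo (Fin d) →ₗ[ℝ] Ltwo (Fin d) where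
  toFun v := (memLp_contractFun β e v).toLp _
  map_add' v w := by
    refine ext_of_slice β ?_
    filter_upwards [slice_toLp_contractFun β e (v + w), slice_toLp_contractFun β e v,
      slice_toLp_contractFun β e w, slice_add β v w, slice_add β
      ((memLp_contractFun β e v).toLp _) ((memLp_contractFun β e w).toLp _)] with y h1 h2 h3 h4 h5
    rw [h1, h5, h2, h3, h4, inner_add_right, add_smul]
  map_smul' c v := by
    refine ext_of_slice β ?_
    filter_upwards [slice_toLp_contractFun β e (c • v), slice_toLp_contractFun β e v,
      slice_smul β c v, slice_smul β c ((memLp_contractFun β e v).toLp _)] with y h1 h2 h3 h4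
    rw [h1, RingHom.id_apply, h4, h2, h3, inner_smul_right, smul_smul]

lemma coeFn_contract (β : Finset (Fin d)) (e : Ltwo {i // i ∈ β}) (v : Ltwo (Fin d)) :
    contract β e v =ᵐ[cube (Fin d)] contractFun β e v :=
  (memLp_contractFun β e v).coeFn_toLp

lemma slice_contract (β : Finset (Fin d)) (e : Ltwo {i // i ∈ β}) (v : Ltwo (Fin d)) :
    ∀ᵐ y ∂cube {i // i ∉ β}, slice β (contract β e v) y = inner ℝ e (slice β v y) • e :=
  slice_toLp_contractFun β e v

/-- The projection onto a finite-dimensional space `V` in the directions of `β`. -/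
def nodeProj (β : Finset (Fin d)) (V : Submodule ℝ (Ltwo {i // i ∈ β})) [FiniteDimensional ℝ V] :
    Ltwo (Fin d) →ₗ[ℝ] Ltwo (Fin d) :=
  ∑ k, contract β (stdOrthonormalBasis ℝ V k : Ltwo {i // i ∈ β})

/-- The contractions by an orthonormal basis of `V` add up to the orthogonal projection on each
slice. -/
lemma slice_nodeProj (β : Finset (Fin d)) (V : Submodule ℝ (Ltwo {i // i ∈ β}))
    [FiniteDimensional ℝ V] (v : Ltwo (Fin d)) :
    ∀ᵐ y ∂cube {i // i ∉ β}, slice β (nodeProj β V v) y = V.starProjection (slice β v y) := by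
  rw [nodeProj, LinearMap.sum_apply]
  filter_upwards [slice_sum Finset.univ β
    (fun k => contract β (stdOrthonormalBasis ℝ V k : Ltwo {i // i ∈ β}) v),
    ae_all_iff.2 fun k => slice_contract β (stdOrthonormalBasis ℝ V k : Ltwo {i // i ∈ β}) v]
    with y h1 h2
  rw [h1, (stdOrthonormalBasis ℝ V).starProjection_eq_sum_rankOne]
  simp [h2]

/-! ### The error of a single projection -/

lemma integrable_infDist_sq (α : Finset (Fin d)) (f : Ltwo (Fin d))
    (V : Submodule ℝ (Ltwo {i // i ∈ α})) :
    Integrable (fun y => Metric.infDist (slice α f y) (V : Set (Ltwo {i // i ∈ α})) ^ 2)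
      (cube {i // i ∉ α}) := by
  refine (integrable_norm_sq_slice α f).mono'
    (((Metric.continuous_infDist_pt _).comp_stronglyMeasurable
      (stronglyMeasurable_slice α f)).pow 2).aestronglyMeasurable (ae_of_all _ fun y => ?_)
  rw [Real.norm_eq_abs, abs_of_nonneg (sq_nonneg _)]
  have := Metric.infDist_le_dist_of_mem (x := slice α f y) V.zero_mem
  rw [dist_zero_right] at this
  exact pow_le_pow_left₀ Metric.infDist_nonneg this 2

/-- Pythagoras: u - Pu is orthogonal to P(u - v), and P does not increase norms. -/
lemma norm_sub_starProjection_sq_le {E : Type*} [NormedAddCommGroup E] [InnerProductSpace ℝ E]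
    (V : Submodule ℝ E) [V.HasOrthogonalProjection] (u v : E) :
    ‖u - V.starProjection v‖ ^ 2 ≤ Metric.infDist u (V : Set E) ^ 2 + ‖u - v‖ ^ 2 := by
  have h1 : u - V.starProjection v = (u - V.starProjection u) + V.starProjection (u - v) := by
    rw [map_sub]; abel
  have h2 : inner ℝ (u - V.starProjection u) (V.starProjection (u - v)) = 0 :=
    V.starProjection_inner_eq_zero u _ (V.starProjection_apply_mem _)
  have h3 : ‖u - V.starProjection u‖ = Metric.infDist u (V : Set E) := by
    rw [V.starProjection_minimal, Metric.infDist_eq_iInf]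
    simp only [dist_eq_norm]
    rfl
  rw [h1, norm_add_sq_real, h2, h3]
  have := pow_le_pow_left₀ (norm_nonneg _) (V.norm_starProjection_apply_le (u - v)) 2
  linarith

lemma norm_sub_nodeProj_sq_le (β : Finset (Fin d)) (V : Submodule ℝ (Ltwo {i // i ∈ β}))
    [FiniteDimensional ℝ V] (f v : Ltwo (Fin d)) :
    ‖f - nodeProj β V v‖ ^ 2 ≤ sqProjError β f V + ‖f - v‖ ^ 2 := by
  rw [norm_sq_eq_integral_slice β, norm_sq_eq_integral_slice β (f - v), sqProjError,
    ← integral_add (integrable_infDist_sq β f V) (integrable_norm_sq_slice β _)]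
  refine integral_mono_ae (integrable_norm_sq_slice β _)
    ((integrable_infDist_sq β f V).add (integrable_norm_sq_slice β _)) ?_
  filter_upwards [slice_nodeProj β V v, slice_sub β f v, slice_sub β f (nodeProj β V v)]
    with y h1 h2 h3
  simp only [h3, h1, h2]
  exact norm_sub_starProjection_sq_le V _ _

/-! ### Separated representations -/

lemma glue_eq_of_corestr (β : Finset (Fin d)) {γ : Type*} {G : (Fin d → ℝ) → γ}
    (hG : DependsOn G (β : Set (Fin d))ᶜ) (x x' : {i // i ∈ β} → ℝ) (y : {i // i ∉ β} → ℝ) :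
    G (glue β x y) = G (glue β x' y) := by
  refine hG fun i hi => ?_
  have hi' : i ∉ β := hi
  simp [glue, hi']

lemma glue_eq_of_restr (β : Finset (Fin d)) {γ : Type*} {F : (Fin d → ℝ) → γ}
    (hF : DependsOn F (β : Set (Fin d))) (x : {i // i ∈ β} → ℝ) (y y' : {i // i ∉ β} → ℝ) :
    F (glue β x y) = F (glue β x y') := by
  refine hF fun i hi => ?_
  have hi' : i ∈ β := hi
  simp [glue, hi']

/-- `G` is constant along each slice, so it may be evaluated at any point of it; 0 is an arbitrary
choice. -/
lemma slice_of_ae_eq_mul (β : Finset (Fin d)) {v w : Ltwo (Fin d)} {G : (Fin d → ℝ) → ℝ}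
    (hG : DependsOn G (β : Set (Fin d))ᶜ) (h : v =ᵐ[cube (Fin d)] fun z => w z * G z) :
    ∀ᵐ y ∂cube {i // i ∉ β}, slice β v y = G (glue β 0 y) • slice β w y := by
  filter_upwards [ae_coeFn_slice β h, ae_coeFn_slice β (ae_eq_refl (f := w))] with y h1 h2
  refine Lp.ext ?_
  filter_upwards [h1, h2, Lp.coeFn_smul (G (glue β 0 y)) (slice β w y)] with x h1 h2 h3
  rw [h1, h3, Pi.smul_apply, h2, smul_eq_mul, mul_comm, glue_eq_of_corestr β hG x 0 y]

lemma contract_ae_eq_mul (β : Finset (Fin d)) (e : Ltwo {i // i ∈ β}) {v w : Ltwo (Fin d)}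
    {G : (Fin d → ℝ) → ℝ} (hG : DependsOn G (β : Set (Fin d))ᶜ)
    (h : v =ᵐ[cube (Fin d)] fun z => w z * G z) :
    contract β e v =ᵐ[cube (Fin d)] fun z => contract β e w z * G z := by
  filter_upwards [coeFn_contract β e v, coeFn_contract β e w,
    (measurePreserving_corestr β).quasiMeasurePreserving.ae (slice_of_ae_eq_mul β hG h)]
    with z h1 h2 h3
  have hz : G (glue β 0 (corestr β z)) = G z := by
    rw [glue_eq_of_corestr β hG 0 (restr β z), glue_restr_corestr]
  rw [h1, h2, contractFun, contractFun, h3, inner_smul_right, hz]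
  ring

/-- The factor `c` integrates `F`, rather than the representative of `v`, against `e` over the
variables in `β`. Its independence of these variables then holds at every point, as `DependsOn`
requires, and not just almost everywhere. -/
lemma exists_contract_ae_eq (β : Finset (Fin d)) (e : Ltwo {i // i ∈ β}) {s : Set (Fin d)}
    {v : Ltwo (Fin d)} {F : (Fin d → ℝ) → ℝ} (hF : DependsOn F s) (h : v =ᵐ[cube (Fin d)] F) :
    ∃ c : (Fin d → ℝ) → ℝ, MemLp c 2 (cube (Fin d)) ∧ DependsOn c (s \ β) ∧
      contract β e v =ᵐ[cube (Fin d)] fun z => e (restr β z) * c z := by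
  have hc : ∀ᵐ z ∂cube (Fin d), inner ℝ e (slice β v (corestr β z)) =
      ∫ x, e x * F (glue β x (corestr β z)) ∂cube {i // i ∈ β} := by
    refine (measurePreserving_corestr β).quasiMeasurePreserving.ae
      (p := fun y => inner ℝ e (slice β v y) =
        ∫ x, e x * F (glue β x y) ∂cube {i // i ∈ β}) ?_
    filter_upwards [ae_coeFn_slice β h] with y hy
    rw [L2.inner_def]
    refine integral_congr_ae ?_
    filter_upwards [hy] with x hx
    rw [hx]
    simp [mul_comm]
  refine ⟨fun z => ∫ x, e x * F (glue β x (corestr β z)) ∂cube {i // i ∈ β}, ?_, ?_, ?_⟩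
  · exact (((memLp_slice β v).const_inner e).comp_measurePreserving
      (measurePreserving_corestr β)).ae_eq hc
  · intro z z' hz
    refine integral_congr_ae (ae_of_all _ fun x => ?_)
    have : F (glue β x (corestr β z)) = F (glue β x (corestr β z')) := by
      refine hF fun i hi => ?_
      by_cases hiβ : i ∈ β
      · simp [glue, hiβ]
      · simpa [glue, hiβ, corestr] using hz i ⟨hi, hiβ⟩
    simp only [this]
  · filter_upwards [coeFn_contract β e v, hc] with z h1 h2
    rw [h1, contractFun, h2]

/-- `v` is the product of a function of the variables in `s` and one of the other variables. -/
def IsProd (s : Set (Fin d)) (v : Ltwo (Fin d)) : Prop :=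
  ∃ F G : (Fin d → ℝ) → ℝ, MemLp F 2 (cube (Fin d)) ∧ MemLp G 2 (cube (Fin d)) ∧
    DependsOn F s ∧ DependsOn G sᶜ ∧ v =ᵐ[cube (Fin d)] fun z => F z * G z

lemma IsProd.compl {s : Set (Fin d)} {v : Ltwo (Fin d)} (h : IsProd s v) : IsProd sᶜ v := by
  obtain ⟨F, G, hF, hG, hFs, hGs, h⟩ := h
  refine ⟨G, F, hG, hF, hGs, by rwa [compl_compl], ?_⟩
  simpa only [mul_comm] using h

lemma coeFn_nodeProj (β : Finset (Fin d)) (V : Submodule ℝ (Ltwo {i // i ∈ β}))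
    [FiniteDimensional ℝ V] (v : Ltwo (Fin d)) :
    nodeProj β V v =ᵐ[cube (Fin d)] fun z =>
      ∑ k, contract β (stdOrthonormalBasis ℝ V k : Ltwo {i // i ∈ β}) v z := by
  rw [nodeProj, LinearMap.sum_apply]
  filter_upwards [Lp.coeFn_finsetSum Finset.univ
    fun k => contract β (stdOrthonormalBasis ℝ V k : Ltwo {i // i ∈ β}) v] with z hz
  simpa using hz

lemma dependsOn_restr (β : Finset (Fin d)) {γ : Type*} (e : ({i // i ∈ β} → ℝ) → γ) :
    DependsOn (fun z => e (restr β z)) (β : Set (Fin d)) := by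
  intro z z' h
  have : restr β z = restr β z' := funext fun i => h i i.2
  simp only [this]

lemma dependsOn_finsetSum {ι : Type*} (I : Finset ι) {s : Set (Fin d)}
    {F : ι → (Fin d → ℝ) → ℝ} (h : ∀ k ∈ I, DependsOn (F k) s) :
    DependsOn (fun z => ∑ k ∈ I, F k z) s :=
  fun _ _ hz => Finset.sum_congr rfl fun k hk => h k hk hz

lemma dependsOn_mul {s : Set (Fin d)} {F G : (Fin d → ℝ) → ℝ} (hF : DependsOn F s)
    (hG : DependsOn G s) : DependsOn (fun z => F z * G z) s :=
  fun _ _ hz => congrArg₂ _ (hF hz) (hG hz)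

/-- The projection acts on the factor `F` alone. The sum over the basis of `V` is absorbed into the
new first factor, so a single product remains a single product. -/
lemma IsProd.nodeProj {s : Set (Fin d)} {β : Finset (Fin d)} (hβ : (β : Set (Fin d)) ⊆ s)
    (V : Submodule ℝ (Ltwo {i // i ∈ β})) [FiniteDimensional ℝ V] {v : Ltwo (Fin d)}
    (h : IsProd s v) : IsProd s (nodeProj β V v) := by
  obtain ⟨F, G, hF, hG, hFs, hGs, h⟩ := h
  have hw : v =ᵐ[cube (Fin d)] fun z => hF.toLp F z * G z := by
    filter_upwards [h, hF.coeFn_toLp] with z h1 h2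
    rw [h1, h2]
  choose c hc hcs hce using fun k => exists_contract_ae_eq β
    (stdOrthonormalBasis ℝ V k : Ltwo {i // i ∈ β}) hFs hF.coeFn_toLp
  have key : TreeTensor.nodeProj β V (hF.toLp F) =ᵐ[cube (Fin d)] fun z =>
      ∑ k, (stdOrthonormalBasis ℝ V k : Ltwo {i // i ∈ β}) (restr β z) * c k z := by
    filter_upwards [coeFn_nodeProj β V (hF.toLp F), ae_all_iff.2 hce] with z h1 h2
    rw [h1]
    exact Finset.sum_congr rfl fun k _ => h2 k
  refine ⟨_, G, (Lp.memLp _).ae_eq key, hG, ?_, hGs, ?_⟩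
  · exact dependsOn_finsetSum _ fun k _ => dependsOn_mul ((dependsOn_restr β _).mono hβ)
      ((hcs k).mono sdiff_subset)
  · filter_upwards [key, coeFn_nodeProj β V v, coeFn_nodeProj β V (hF.toLp F),
      ae_all_iff.2 fun k => contract_ae_eq_mul β
        (stdOrthonormalBasis ℝ V k : Ltwo {i // i ∈ β})
        (hGs.mono (compl_subset_compl.2 hβ)) hw] with z h1 h2 h3 h4
    rw [← h1, h2, h3, Finset.sum_mul]
    exact Finset.sum_congr rfl fun k _ => h4 k

/-- `v` is a sum of `n` products of functions of the variables in `s` and in its complement. -/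
def IsSep (s : Set (Fin d)) (n : ℕ) (v : Ltwo (Fin d)) : Prop :=
  ∃ t : Fin n → Ltwo (Fin d), (∀ k, IsProd s (t k)) ∧ v = ∑ k, t k

lemma IsSep.nodeProj {α β : Finset (Fin d)} (hβ : β ⊆ α ∨ Disjoint α β) {n : ℕ}
    (V : Submodule ℝ (Ltwo {i // i ∈ β})) [FiniteDimensional ℝ V] {v : Ltwo (Fin d)}
    (h : IsSep (α : Set (Fin d)) n v) : IsSep (α : Set (Fin d)) n (nodeProj β V v) := by
  obtain ⟨t, ht, rfl⟩ := h
  refine ⟨fun k => TreeTensor.nodeProj β V (t k), fun k => ?_, map_sum _ _ _⟩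
  rcases hβ with hβ | hβ
  · exact (ht k).nodeProj (by exact_mod_cast hβ) V
  -- In the disjoint case the other factor is projected: the two factors exchange their roles.
  · have hs : (β : Set (Fin d)) ⊆ (α : Set (Fin d))ᶜ :=
      fun i hi hi' => Finset.disjoint_left.1 hβ hi' hi
    simpa only [compl_compl] using ((ht k).compl.nodeProj hs V).compl

lemma isSep_nodeProj (β : Finset (Fin d)) (V : Submodule ℝ (Ltwo {i // i ∈ β}))
    [FiniteDimensional ℝ V] (v : Ltwo (Fin d)) :
    IsSep (β : Set (Fin d)) (Module.finrank ℝ V) (nodeProj β V v) := by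
  refine ⟨fun k => contract β (stdOrthonormalBasis ℝ V k : Ltwo {i // i ∈ β}) v, fun k => ?_,
    by rw [nodeProj, LinearMap.sum_apply]⟩
  obtain ⟨c, hc, hcs, hce⟩ := exists_contract_ae_eq β
    (stdOrthonormalBasis ℝ V k : Ltwo {i // i ∈ β}) (dependsOn_univ (v : (Fin d → ℝ) → ℝ))
    (ae_eq_refl _)
  exact ⟨_, c, (Lp.memLp _).comp_measurePreserving (measurePreserving_restr β), hc,
    dependsOn_restr β _, by rwa [compl_eq_univ_sdiff], hce⟩

lemma isSep_univ (v : Ltwo (Fin d)) :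
    IsSep ((Finset.univ : Finset (Fin d)) : Set (Fin d)) 1 v :=
  ⟨fun _ => v, fun _ => ⟨v, fun _ => 1, Lp.memLp v, memLp_const 1,
    by simpa using dependsOn_univ _, (dependsOn_const _).mono (empty_subset _), by simp⟩, by simp⟩

/-! ### Sums of products have bounded rank -/

lemma integral_mem_of_ae_mem {Ω E : Type*} [MeasurableSpace Ω] {μ : Measure Ω}
    [NormedAddCommGroup E] [InnerProductSpace ℝ E] [CompleteSpace E] (W : Submodule ℝ E)
    [W.HasOrthogonalProjection] {g : Ω → E} (hg : Integrable g μ) (h : ∀ᵐ y ∂μ, g y ∈ W) :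
    ∫ y, g y ∂μ ∈ W := by
  have : ∫ y, g y ∂μ = W.starProjection (∫ y, g y ∂μ) := by
    rw [← W.starProjection.integral_comp_comm hg]
    refine integral_congr_ae ?_
    filter_upwards [h] with y hy
    exact (Submodule.starProjection_eq_self_iff.2 hy).symm
  rw [this]
  exact W.starProjection_apply_mem _

/-- Almost all slices lie in one space spanned by `n` functions, and integration against a weight
does not leave this closed space. -/
lemma IsSep.alphaRank_le {α : Finset (Fin d)} {n : ℕ} {v : Ltwo (Fin d)}
    (h : IsSep (α : Set (Fin d)) n v) : alphaRank α v ≤ n := by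
  obtain ⟨t, ht, rfl⟩ := h
  choose F G hF hG hFs hGs h using ht
  -- Each `F k` ignores the variables outside `α`, so its slice at one generic point represents
  -- almost all of them.
  obtain ⟨y₀, hy₀⟩ := (ae_all_iff.2 fun k => ae_coeFn_slice α (hF k).coeFn_toLp).exists
  let φ : Fin n → Ltwo {i // i ∈ α} := fun k => slice α ((hF k).toLp (F k)) y₀
  have hmem : ∀ᵐ y ∂cube {i // i ∉ α},
      slice α (∑ k, t k) y ∈ Submodule.span ℝ (range φ) := by
    filter_upwards [slice_sum Finset.univ α t, ae_all_iff.2 fun k => ae_coeFn_slice α (h k)]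
      with y h1 h2
    rw [h1]
    refine Submodule.sum_mem _ fun k _ => ?_
    have : slice α (t k) y = G k (glue α 0 y) • φ k := by
      refine Lp.ext ?_
      filter_upwards [h2 k, hy₀ k, Lp.coeFn_smul (G k (glue α 0 y)) (φ k)] with x h3 h4 h5
      rw [h3, h5, Pi.smul_apply, h4, smul_eq_mul, mul_comm,
        glue_eq_of_corestr α (hGs k) x 0 y, glue_eq_of_restr α (hFs k) x y y₀]
    rw [this]
    exact Submodule.smul_mem _ _ (Submodule.subset_span (mem_range_self k))
  have : FiniteDimensional ℝ (Submodule.span ℝ (range φ)) :=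
    FiniteDimensional.span_of_finite ℝ (finite_range φ)
  have hle : LinearMap.range (sliceOp α (∑ k, t k)) ≤ Submodule.span ℝ (range φ) := by
    rintro _ ⟨w, rfl⟩
    refine integral_mem_of_ae_mem _ (integrable_smul_slice α _ w) ?_
    filter_upwards [hmem] with y hy
    exact Submodule.smul_mem _ _ hy
  refine (Submodule.rank_mono hle).trans ?_
  rw [← Module.finrank_eq_rank]
  exact_mod_cast (finrank_range_le_card φ).trans (Fintype.card_fin n).le

section

/-! ### Projections onto tensor product spaces -/

/-- The span of the products `∏_{ν ∈ s} u_ν(x_ν) w(x)` with `u_ν ∈ U_ν` and `w` not depending on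
the variables in `s`. -/
def partialTensorSpace (U : ∀ ν : Fin d, Submodule ℝ (Ltwo {i // i ∈ ({ν} : Finset (Fin d))}))
    (s : Finset (Fin d)) : Submodule ℝ (Ltwo (Fin d)) :=
  Submodule.span ℝ {v | ∃ (u : ∀ ν : Fin d, Ltwo {i // i ∈ ({ν} : Finset (Fin d))})
    (w : (Fin d → ℝ) → ℝ), (∀ ν, u ν ∈ U ν) ∧ MemLp w 2 (cube (Fin d)) ∧
    DependsOn w (s : Set (Fin d))ᶜ ∧
    v =ᵐ[cube (Fin d)] fun z => w z * ∏ ν ∈ s, u ν (restr {ν} z)}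

variable (U : ∀ ν : Fin d, Submodule ℝ (Ltwo {i // i ∈ ({ν} : Finset (Fin d))}))

lemma mem_partialTensorSpace_empty (v : Ltwo (Fin d)) : v ∈ partialTensorSpace U ∅ :=
  Submodule.subset_span ⟨0, v, fun ν => (U ν).zero_mem, Lp.memLp v,
    by simpa using dependsOn_univ _, by simp⟩

/-- As ν ∉ s, contraction leaves the product over `s` untouched and turns `w` into `e` times a
function that no longer depends on the variable ν. -/
lemma contract_mem_partialTensorSpace {s : Finset (Fin d)} {ν : Fin d} (hν : ν ∉ s)
    {e : Ltwo {i // i ∈ ({ν} : Finset (Fin d))}} (he : e ∈ U ν) {v : Ltwo (Fin d)}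
    (hv : v ∈ partialTensorSpace U s) :
    contract {ν} e v ∈ partialTensorSpace U (insert ν s) := by
  suffices partialTensorSpace U s ≤ (partialTensorSpace U (insert ν s)).comap (contract {ν} e) from
    this hv
  refine Submodule.span_le.2 ?_
  rintro v ⟨u, w, hu, hw, hws, h⟩
  have hprod : DependsOn (fun z : Fin d → ℝ => ∏ μ ∈ s, u μ (restr {μ} z))
      ((({ν} : Finset (Fin d)) : Set (Fin d))ᶜ) := by
    intro z z' hz
    refine Finset.prod_congr rfl fun μ hμ => dependsOn_restr {μ} (u μ) fun i hi => hz i ?_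
    have hi : i = μ := by simpa using hi
    subst hi
    simp only [Finset.coe_singleton, mem_compl_iff, mem_singleton_iff]
    rintro rfl
    exact hν hμ
  have h' : v =ᵐ[cube (Fin d)] fun z => hw.toLp w z * ∏ μ ∈ s, u μ (restr {μ} z) := by
    filter_upwards [h, hw.coeFn_toLp] with z h1 h2
    rw [h1, h2]
  obtain ⟨c, hc, hcs, hce⟩ := exists_contract_ae_eq {ν} e hws hw.coeFn_toLp
  refine Submodule.subset_span ⟨Function.update u ν e, c, fun μ => ?_, hc, hcs.mono ?_, ?_⟩
  · by_cases hμ : μ = ν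
    · subst hμ; simpa using he
    · simpa [hμ] using hu μ
  · intro i hi
    simp only [Finset.coe_singleton, mem_sdiff, mem_compl_iff, mem_singleton_iff,
      Finset.coe_insert, mem_insert_iff, not_or] at hi ⊢
    exact ⟨hi.2, hi.1⟩
  · filter_upwards [contract_ae_eq_mul {ν} e hprod h', hce] with z h1 h2
    rw [h1, h2, Finset.prod_insert hν, Function.update_self, mul_assoc, mul_left_comm]
    congr 2
    refine Finset.prod_congr rfl fun μ hμ => ?_
    rw [Function.update_of_ne (ne_of_mem_of_not_mem hμ hν)]

lemma nodeProj_mem_partialTensorSpace {s : Finset (Fin d)} {ν : Fin d} (hν : ν ∉ s)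
    [FiniteDimensional ℝ (U ν)] {v : Ltwo (Fin d)} (hv : v ∈ partialTensorSpace U s) :
    nodeProj {ν} (U ν) v ∈ partialTensorSpace U (insert ν s) := by
  rw [nodeProj, LinearMap.sum_apply]
  exact Submodule.sum_mem _ fun k _ =>
    contract_mem_partialTensorSpace U hν (stdOrthonormalBasis ℝ (U ν) k).2 hv

/-- Once all variables are split off, the remaining factor `w` is a constant, which is scaled away
unless it is 0. -/
lemma partialTensorSpace_univ_le : partialTensorSpace U Finset.univ ≤ tensorSpace U := by
  refine Submodule.span_le.2 ?_
  rintro v ⟨u, w, hu, -, hw, h⟩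
  have hw0 : ∀ z, w z = w 0 := fun z => hw fun i hi => absurd (Finset.mem_coe.2
    (Finset.mem_univ i)) hi
  by_cases h0 : w 0 = 0
  · have : v = 0 := by
      refine Lp.ext ?_
      filter_upwards [h, Lp.coeFn_zero ℝ 2 (cube (Fin d))] with z h1 h2
      rw [h1, h2, hw0, h0, zero_mul, Pi.zero_apply]
    rw [this]
    exact Submodule.zero_mem _
  · have : v = w 0 • (w 0)⁻¹ • v := by rw [smul_smul, mul_inv_cancel₀ h0, one_smul]
    rw [this]
    refine Submodule.smul_mem _ _ (Submodule.subset_span ⟨u, hu, ?_⟩)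
    filter_upwards [h, Lp.coeFn_smul (w 0)⁻¹ v] with z h1 h2
    rw [h2, Pi.smul_apply, h1, hw0 z, smul_eq_mul, inv_mul_cancel_left₀ h0]
    rfl

end

/-! ### Nodes of a dimension partition tree -/

namespace DimTree

variable (T : DimTree d)

lemma subset_of_mem_sons {α β : Finset (Fin d)} (hα : α ∈ T.nodes) (hβ : β ∈ T.sons α) :
    β ⊆ α := by
  conv_rhs => rw [← T.sons_cover α hα ⟨β, hβ⟩]
  exact Finset.subset_biUnion_of_mem id hβ

lemma ssubset_of_mem_sons {α β : Finset (Fin d)} (hα : α ∈ T.nodes) (hβ : β ∈ T.sons α) :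
    β ⊂ α := by
  refine (T.subset_of_mem_sons hα hβ).ssubset_of_ne ?_
  rintro rfl
  have hcard : 2 ≤ (T.sons β).card := (T.leaf_or_two_le β hα).resolve_left
    (Finset.ne_empty_of_mem hβ)
  -- If a node were its own son, a second son would be nonempty, contained in it and disjoint from
  -- it.
  obtain ⟨γ, hγ, hne⟩ := Finset.exists_mem_ne hcard β
  obtain ⟨i, hi⟩ := T.nonempty_of_mem γ (T.sons_subset β hα hγ)
  exact Finset.disjoint_left.1 (T.sons_disjoint β hα γ hγ β hβ hne) hi
    (T.subset_of_mem_sons hα hγ hi)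

/-- Both claims are proved together, from the root downwards. The first, for `α`, uses the second
for a parent of `α`: a node strictly inside the parent lies in one of its sons, which is `α` or
disjoint from `α`. The second follows by climbing from `γ` to a parent, in an inner induction over
larger sets. -/
lemma nested_or_disjoint_and_subset_son (α : Finset (Fin d)) (hα : α ∈ T.nodes) :
    (∀ γ ∈ T.nodes, α ⊆ γ ∨ γ ⊆ α ∨ Disjoint α γ) ∧
      ∀ γ ∈ T.nodes, γ ⊂ α → ∃ δ ∈ T.sons α, γ ⊆ δ := by
  induction α using WellFoundedGT.induction with
  | ind α ih =>
    have hα₁ : ∀ γ ∈ T.nodes, α ⊆ γ ∨ γ ⊆ α ∨ Disjoint α γ := by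
      intro γ hγ
      by_cases hu : α = Finset.univ
      · exact Or.inr (Or.inl (hu ▸ Finset.subset_univ γ))
      obtain ⟨α', hα', hs⟩ := T.exists_parent α hα hu
      have hlt := T.ssubset_of_mem_sons hα' hs
      obtain ⟨h₁, h₂⟩ := ih α' hlt hα'
      rcases h₁ γ hγ with h | h | h
      · exact Or.inl (hlt.subset.trans h)
      · rcases h.eq_or_ssubset with rfl | h
        · exact Or.inl hlt.subset
        · obtain ⟨δ, hδ, hγδ⟩ := h₂ γ hγ h
          by_cases hne : α = δ
          · exact Or.inr (Or.inl (hne ▸ hγδ))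
          · exact Or.inr (Or.inr ((T.sons_disjoint α' hα' α hs δ hδ hne).mono_right hγδ))
      · exact Or.inr (Or.inr (h.mono_left hlt.subset))
    refine ⟨hα₁, fun γ => ?_⟩
    induction γ using WellFoundedGT.induction with
    | ind γ ihγ =>
      intro hγ hγα
      have hu : γ ≠ Finset.univ := fun h =>
        hγα.not_subset (h ▸ Finset.subset_univ α)
      obtain ⟨i, hi⟩ := T.nonempty_of_mem γ hγ
      obtain ⟨γ', hγ', hs⟩ := T.exists_parent γ hγ hu
      have hlt := T.ssubset_of_mem_sons hγ' hs
      by_cases heq : γ' = α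
      · exact ⟨γ, heq ▸ hs, Finset.Subset.refl γ⟩
      rcases hα₁ γ' hγ' with h | h | h
      -- A parent of `γ` strictly above `α` is impossible: `α` would lie in a son `δ` of it, but γ =
      -- δ contradicts γ ⊂ α, and γ ≠ δ makes the nonempty `γ`, a subset of `δ`, disjoint from `δ`.
      · obtain ⟨δ, hδ, hαδ⟩ := (ih γ' (h.ssubset_of_ne (Ne.symm heq)) hγ').2 α hα
          (h.ssubset_of_ne (Ne.symm heq))
        by_cases hne : γ = δ
        · exact absurd (hne ▸ hαδ) hγα.not_subset
        · exact absurd (hαδ (hγα.subset hi))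
            (Finset.disjoint_left.1 (T.sons_disjoint γ' hγ' γ hs δ hδ hne) hi)
      · obtain ⟨δ, hδ, hγδ⟩ := ihγ γ' hlt hγ' (h.ssubset_of_ne heq)
        exact ⟨δ, hδ, hlt.subset.trans hγδ⟩
      · exact absurd (hlt.subset hi) (Finset.disjoint_left.1 h (hγα.subset hi))

lemma nested_or_disjoint {α γ : Finset (Fin d)} (hα : α ∈ T.nodes) (hγ : γ ∈ T.nodes) :
    α ⊆ γ ∨ γ ⊆ α ∨ Disjoint α γ :=
  (T.nested_or_disjoint_and_subset_son α hα).1 γ hγ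

end DimTree

/-! ### Successive projections -/

lemma exists_isSep_norm_sub_sq_le (T : DimTree d) (r : Finset (Fin d) → ℕ) (f : Ltwo (Fin d))
    (V : ∀ α : Finset (Fin d), Submodule ℝ (Ltwo {i // i ∈ α})) (S : Finset (Finset (Fin d)))
    (hS : S ⊆ T.nodes) (hV : ∀ α ∈ S, Module.rank ℝ (V α) = r α) :
    ∃ v : Ltwo (Fin d), (∀ α ∈ S, IsSep (α : Set (Fin d)) (r α) v) ∧
      ‖f - v‖ ^ 2 ≤ ∑ α ∈ S, sqProjError α f (V α) := by
  -- The node inserted has minimal cardinality, so large nodes are projected first. No node treated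
  -- earlier is then strictly contained in the current one.
  induction S using Finset.induction_on_min_value (Finset.card : Finset (Fin d) → ℕ) with
  | empty => exact ⟨f, by simp, by simp⟩
  | insert β S hβ hmin ih =>
    obtain ⟨v, hv, hfv⟩ := ih ((Finset.subset_insert _ _).trans hS)
      fun α hα => hV α (Finset.mem_insert_of_mem hα)
    have hrank := hV β (Finset.mem_insert_self _ _)
    have : FiniteDimensional ℝ (V β) := Module.finite_of_rank_eq_nat hrank
    refine ⟨nodeProj β (V β) v, fun α hα => ?_, ?_⟩
    · rcases Finset.mem_insert.1 hα with rfl | hα'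
      · rw [← Module.finrank_eq_of_rank_eq hrank]
        exact isSep_nodeProj α (V α) v
      · refine (hv α hα').nodeProj ?_ (V β)
        rcases T.nested_or_disjoint (hS hα) (hS (Finset.mem_insert_self β S)) with h | h | h
        · exact Or.inl (Finset.eq_of_subset_of_card_le h (hmin α hα')).ge
        · exact Or.inl h
        · exact Or.inr h
    · rw [Finset.sum_insert hβ]
      exact (norm_sub_nodeProj_sq_le β (V β) f v).trans (by gcongr)

lemma exists_mem_partialTensorSpace_norm_sub_sq_le
    (U : ∀ ν : Fin d, Submodule ℝ (Ltwo {i // i ∈ ({ν} : Finset (Fin d))}))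
    [∀ ν, FiniteDimensional ℝ (U ν)] (f v : Ltwo (Fin d)) (s : Finset (Fin d)) :
    ∃ w ∈ partialTensorSpace U s,
      (∀ (α : Finset (Fin d)) (n : ℕ), IsSep (α : Set (Fin d)) n v →
        IsSep (α : Set (Fin d)) n w) ∧
      (∀ ν ∈ s, IsSep (({ν} : Finset (Fin d)) : Set (Fin d)) (Module.finrank ℝ (U ν)) w) ∧
      ‖f - w‖ ^ 2 ≤ ∑ ν ∈ s, sqProjError {ν} f (U ν) + ‖f - v‖ ^ 2 := by
  induction s using Finset.induction_on with
  | empty => exact ⟨v, mem_partialTensorSpace_empty U v, fun _ _ h => h, by simp, by simp⟩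
  | insert μ s hμ ih =>
    obtain ⟨w, hw, hsep, hs, hfw⟩ := ih
    have hpres : ∀ (α : Finset (Fin d)) (n : ℕ), IsSep (α : Set (Fin d)) n w →
        IsSep (α : Set (Fin d)) n (nodeProj {μ} (U μ) w) := by
      intro α n h
      refine h.nodeProj ?_ (U μ)
      rw [Finset.singleton_subset_iff, Finset.disjoint_singleton_right]
      exact em _
    refine ⟨nodeProj {μ} (U μ) w, nodeProj_mem_partialTensorSpace U hμ hw,
      fun α n h => hpres α n (hsep α n h), fun ν hν => ?_, ?_⟩
    · rcases Finset.mem_insert.1 hν with rfl | hν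
      · exact isSep_nodeProj {ν} (U ν) w
      · exact hpres _ _ (hs ν hν)
    · rw [Finset.sum_insert hμ, add_assoc]
      exact (norm_sub_nodeProj_sq_le {μ} (U μ) f w).trans (by gcongr)

lemma bestError_sq_le {T : DimTree d} {r : Finset (Fin d) → ℕ} {W : Submodule ℝ (Ltwo (Fin d))}
    {f v : Ltwo (Fin d)} (hv : v ∈ W)
    (h : ∀ α ∈ T.nodes, IsSep (α : Set (Fin d)) (r α) v) :
    bestError T r W f ^ 2 ≤ ‖f - v‖ ^ 2 := by
  have hmem : v ∈ treeFormat T r W := ⟨hv, fun α hα => (h α hα).alphaRank_le⟩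
  rw [← dist_eq_norm]
  exact pow_le_pow_left₀ Metric.infDist_nonneg (Metric.infDist_le_dist_of_mem hmem) 2

/-! ### Passing to the widths -/

/-- This keeps the infimum defining `width` from ranging over the empty set, where its value would
be 0. Nonemptiness of `α` is essential, since L² of a point is one-dimensional. -/
lemma exists_submodule_rank_eq {α : Finset (Fin d)} (hα : α.Nonempty) (n : ℕ) :
    ∃ V : Submodule ℝ (Ltwo {i // i ∈ α}), Module.rank ℝ V = (n : Cardinal) := by
  obtain ⟨i₀, hi₀⟩ := hα
  -- Slabs over the disjoint intervals (1/(k+2), 1/(k+1)) of (0,1) have positive measure; their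
  -- indicators are orthogonal and nonzero.
  let A : ℕ → Set ({i // i ∈ α} → ℝ) := fun k =>
    (fun x => x ⟨i₀, hi₀⟩) ⁻¹' Ioo ((k + 2 : ℝ)⁻¹) ((k + 1 : ℝ)⁻¹)
  have hA : ∀ k, MeasurableSet (A k) := fun k => measurable_pi_apply _ measurableSet_Ioo
  have hdisj : ∀ j k, j < k → A j ∩ A k = ∅ := by
    intro j k hjk
    ext x
    simp only [A, mem_inter_iff, mem_preimage, mem_Ioo, mem_empty_iff_false, iff_false]
    rintro ⟨⟨h1, -⟩, -, h2⟩
    have h3 : (j + 2 : ℝ) ≤ k + 1 := by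
      have : (j + 1 : ℝ) ≤ k := by exact_mod_cast hjk
      linarith
    have h4 : ((k + 1 : ℝ)⁻¹) ≤ (j + 2 : ℝ)⁻¹ := inv_anti₀ (by positivity) h3
    linarith
  have hpos : ∀ k, (cube {i // i ∈ α}) (A k) ≠ 0 := by
    intro k
    have : IsProbabilityMeasure ((volume : Measure ℝ).restrict (Ioo (0 : ℝ) 1)) := ⟨by simp⟩
    have hmp : MeasurePreserving (fun x : {i // i ∈ α} → ℝ => x ⟨i₀, hi₀⟩)
        (cube {i // i ∈ α}) ((volume : Measure ℝ).restrict (Ioo 0 1)) :=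
      measurePreserving_eval (fun _ => (volume : Measure ℝ).restrict (Ioo 0 1)) _
    have hsub : Ioo ((k + 2 : ℝ)⁻¹) ((k + 1 : ℝ)⁻¹) ∩ Ioo 0 1 =
        Ioo ((k + 2 : ℝ)⁻¹) ((k + 1 : ℝ)⁻¹) := by
      refine inter_eq_left.2 (Ioo_subset_Ioo (by positivity) (inv_le_one_of_one_le₀ ?_))
      linarith [(Nat.cast_nonneg k : (0 : ℝ) ≤ k)]
    rw [hmp.measure_preimage measurableSet_Ioo.nullMeasurableSet,
      Measure.restrict_apply measurableSet_Ioo, hsub, Real.volume_Ioo]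
    simp only [ne_eq, ENNReal.ofReal_eq_zero, not_le, sub_pos]
    exact inv_strictAnti₀ (by positivity) (by linarith)
  let e : ℕ → Ltwo {i // i ∈ α} := fun k =>
    indicatorConstLp 2 (hA k) (measure_ne_top _ _) (1 : ℝ)
  have hinner : ∀ j k, inner ℝ (e j) (e k) = (cube {i // i ∈ α}).real (A j ∩ A k) := fun j k =>
    L2.inner_indicatorConstLp_one_indicatorConstLp_one (𝕜 := ℝ) (hA j) (hA k)
      (measure_ne_top _ _) (measure_ne_top _ _)
  have hli : LinearIndependent ℝ fun k : Fin n => e k := by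
    refine linearIndependent_of_ne_zero_of_inner_eq_zero (fun k h => ?_) fun j k hjk => ?_
    · have := hinner k k
      rw [h, inner_zero_left, inter_self] at this
      exact (measureReal_ne_zero_iff).2 (hpos k) this.symm
    · change inner ℝ (e j) (e k) = 0
      rw [hinner]
      rcases lt_or_gt_of_ne (fun h => hjk (Fin.ext h) : (j : ℕ) ≠ k) with h | h
      · rw [hdisj j k h, measureReal_empty]
      · rw [inter_comm, hdisj k j h, measureReal_empty]
  refine ⟨Submodule.span ℝ (range fun k : Fin n => e k), ?_⟩
  rw [rank_span hli, Cardinal.mk_range_eq _ hli.injective, Cardinal.mk_fin]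

/-- No minimising subspace is needed. The bound `c` may be negative, in which case `√c` is 0. -/
lemma le_width_sq {α : Finset (Fin d)} (hα : α.Nonempty) {n : ℕ} {f : Ltwo (Fin d)} {c : ℝ}
    (h : ∀ V : Submodule ℝ (Ltwo {i // i ∈ α}), Module.rank ℝ V = (n : Cardinal) →
      c ≤ sqProjError α f V) : c ≤ width α n f ^ 2 := by
  obtain ⟨V₀, hV₀⟩ := exists_submodule_rank_eq hα n
  have : Nonempty {V : Submodule ℝ (Ltwo {i // i ∈ α}) // Module.rank ℝ V = (n : Cardinal)} :=
    ⟨⟨V₀, hV₀⟩⟩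
  have hle : √c ≤ width α n f := le_ciInf fun V => Real.sqrt_le_sqrt (h V.1 V.2)
  exact (Real.sqrt_le_left (Real.sqrt_nonneg c |>.trans hle)).1 hle

/-- The infimum is taken at one node while the subspaces at the others stay fixed, their errors
being moved to the other side. -/
lemma le_add_sum_width_sq (r : Finset (Fin d) → ℕ) (f : Ltwo (Fin d)) {c C : ℝ}
    (S : Finset (Finset (Fin d))) (hS : ∀ α ∈ S, α.Nonempty)
    (h : ∀ V : ∀ α : Finset (Fin d), Submodule ℝ (Ltwo {i // i ∈ α}),
      (∀ α ∈ S, Module.rank ℝ (V α) = (r α : Cardinal)) →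
        c ≤ C + ∑ α ∈ S, sqProjError α f (V α)) :
    c ≤ C + ∑ α ∈ S, width α (r α) f ^ 2 := by
  induction S using Finset.induction_on generalizing C with
  | empty => simpa using h (fun _ => ⊥) (by simp)
  | insert β S hβ ih =>
    rw [Finset.sum_insert hβ, ← add_assoc]
    refine ih (fun α hα => hS α (Finset.mem_insert_of_mem hα)) fun V hV => ?_
    suffices c - C - ∑ α ∈ S, sqProjError α f (V α) ≤ width β (r β) f ^ 2 by linarith
    refine le_width_sq (hS β (Finset.mem_insert_self _ _)) fun V' hV' => ?_
    have hne : ∀ α ∈ S, α ≠ β := fun α hα => ne_of_mem_of_not_mem hα hβ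
    have := h (Function.update V β V') fun α hα => by
      rcases Finset.mem_insert.1 hα with rfl | hα
      · rwa [Function.update_self]
      · rw [Function.update_of_ne (hne α hα)]
        exact hV α hα
    rw [Finset.sum_insert hβ, Function.update_self, Finset.sum_congr rfl fun α hα => by
      rw [Function.update_of_ne (hne α hα)]] at this
    linarith

end TreeTensor

end

/-! ### The error bounds for the tree format -/

theorem mainTheorem7 (d : ℕ) (hd : 2 ≤ d) (T : TreeTensor.DimTree d)
    (r : Finset (Fin d) → ℕ) (hroot : r Finset.univ = 1) (hr : TreeTensor.Admissible T r)
    (f : TreeTensor.Ltwo (Fin d)) :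
    TreeTensor.bestError T r ⊤ f ^ 2 ≤
        ∑ α ∈ T.nodes.erase Finset.univ, TreeTensor.width α (r α) f ^ 2 ∧
    ∀ U : ∀ ν : Fin d, Submodule ℝ (TreeTensor.Ltwo {i // i ∈ ({ν} : Finset (Fin d))}),
      (∀ ν, Module.Finite ℝ (U ν)) →
      TreeTensor.bestError T r (TreeTensor.tensorSpace U) f ^ 2 ≤
          ∑ ν, TreeTensor.sqProjError {ν} f (U ν) +
            ∑ α ∈ T.nodes.erase Finset.univ, TreeTensor.width α (r α) f ^ 2 ∧
      ((∀ ν, Module.finrank ℝ (U ν) = r {ν}) →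
        TreeTensor.bestError T r (TreeTensor.tensorSpace U) f ^ 2 ≤
          ∑ ν, TreeTensor.sqProjError {ν} f (U ν) +
            ∑ α ∈ T.interior.erase Finset.univ, TreeTensor.width α (r α) f ^ 2) := by
  open TreeTensor in
  have hnodes : T.nodes.erase Finset.univ ⊆ T.nodes := Finset.erase_subset _ _
  have hint : T.interior.erase Finset.univ ⊆ T.nodes :=
    (Finset.erase_subset _ _).trans (Finset.filter_subset _ _)
  have hsep : ∀ v : Ltwo (Fin d), (∀ α ∈ T.nodes.erase Finset.univ,
      IsSep (α : Set (Fin d)) (r α) v) → ∀ α ∈ T.nodes, IsSep (α : Set (Fin d)) (r α) v := by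
    intro v h α hα
    by_cases hu : α = Finset.univ
    -- The root needs no projection: every function is a single product with the constant 1.
    · rw [hu, hroot]
      exact isSep_univ v
    · exact h α (Finset.mem_erase.2 ⟨hu, hα⟩)
  refine ⟨?_, fun U hU => ⟨?_, fun hdim => ?_⟩⟩
  · rw [← zero_add (∑ α ∈ T.nodes.erase Finset.univ, width α (r α) f ^ 2)]
    refine le_add_sum_width_sq r f _ (fun α hα => T.nonempty_of_mem α (hnodes hα)) fun V hV => ?_
    obtain ⟨v, hv, hfv⟩ := exists_isSep_norm_sub_sq_le T r f V _ hnodes hV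
    rw [zero_add]
    exact (bestError_sq_le Submodule.mem_top (hsep v hv)).trans hfv
  · refine le_add_sum_width_sq r f _ (fun α hα => T.nonempty_of_mem α (hnodes hα)) fun V hV => ?_
    obtain ⟨v, hv, hfv⟩ := exists_isSep_norm_sub_sq_le T r f V _ hnodes hV
    obtain ⟨w, hwU, hw, -, hfw⟩ := exists_mem_partialTensorSpace_norm_sub_sq_le U f v Finset.univ
    refine (bestError_sq_le (partialTensorSpace_univ_le U hwU)
      (hsep w fun α hα => hw α _ (hv α hα))).trans (hfw.trans ?_)
    gcongr
  · refine le_add_sum_width_sq r f _ (fun α hα => T.nonempty_of_mem α (hint hα)) fun V hV => ?_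
    obtain ⟨v, hv, hfv⟩ := exists_isSep_norm_sub_sq_le T r f V _ hint hV
    obtain ⟨w, hwU, hw, hwν, hfw⟩ :=
      exists_mem_partialTensorSpace_norm_sub_sq_le U f v Finset.univ
    refine (bestError_sq_le (partialTensorSpace_univ_le U hwU)
      (hsep w fun α hα => ?_)).trans (hfw.trans ?_)
    · obtain ⟨hu, hα⟩ := Finset.mem_erase.1 hα
      by_cases hs : (T.sons α).Nonempty
      · exact hw α _ (hv α (Finset.mem_erase.2 ⟨hu, Finset.mem_filter.2 ⟨hα, hs⟩⟩))
      -- A leaf is a singleton {ν}; its rank bound comes from the projection onto `U ν`, whose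
      -- dimension is exactly `r {ν}`.
      · obtain ⟨ν, rfl⟩ := Finset.card_eq_one.1
          (T.card_leaf α hα (Finset.not_nonempty_iff_eq_empty.1 hs))
        rw [← hdim ν]
        exact hwν ν (Finset.mem_univ ν)
    · gcongr
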